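/- Let $s$ subsystems have state dimensions $n_1,\dots,n_s$ and measurement dimensions $m_1,\dots,m_s$. Given blocks $A_{ij}(k)\in\mathbb R^{n_i\times n_j}$ ($k\ge 0$), $C_i(k)\in\mathbb R^{m_i\times n_i}$ ($k\ge 1$), scalars $\vartheta_i(k)$, symmetric weights $Q_i(k)$ ($k\ge0$), $R_i(k)$ ($k\ge1$) and initial matrices $P_i(0)\ge 0$, the distributed modified Riccati equation (DMRE) is the recursion, for $k\ge 0$, $$\bar P_i(k+1)=\vartheta_i^2(k)\sum_{j\in\mathbb I_i(k)\cup\{i\}}A_{ij}(k)P_j(k)A_{ij}^\top(k)+Q_i(k),\qquad \mathbb I_i(k)=\{j\ne i: A_{ij}(k)\neq 0\},$$ $$P_i(k)=\bar P_i(k)-\bar P_i(k)C_i^\top(k)\big(C_i(k)\bar P_i(k)C_i^\top(k)+R_i(k)\big)^{-1}C_i(k)\bar P_i(k)\quad(k\ge1),$$ and $P(k)=\mathrm{Diag}(P_1(k),\dots,P_s(k))$. Norms are Euclidean norms of vectors and 2-norms of matrices, and $X\ge Y$ means that $X-Y$ is symmetric positive semidefinite. For a sequence of square matrices $X(k)$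 put $\Phi_X(k,k)=I$ and $\Phi_X(k+t,k)=X(k+t-1)\cdots X(k)$. A pair $(Y(k),X(k))_{k\ge1}$ is uniformly detectable if there are integers $\nu\ge\mu\ge0$ and reals $0\le\gamma<1$, $\sigma>0$ such that for all $k\ge1$ and all vectors $\xi$: whenever $\|\Phi_X(k+\mu,k)\xi\|\ge\gamma\|\xi\|$, then $\xi^\top\sum_{i=0}^{\nu}\Phi_X^\top(k+i,k)Y^\top(k+i)Y(k+i)\Phi_X(k+i,k)\,\xi\ge\sigma\|\xi\|^2$. **Theorem.** Fix the local data $A_{ii}(k)$, $C_i(k)$, $\vartheta_i(k)$, $Q_i(k)$, $R_i(k)$, $i=1,\dots,s$, where $\|A_{ii}(k)\|$ $(k\ge0)$ and $\|C_i(k)\|$ $(k\ge1)$ are uniformly bounded. Assume that for every $i$ there are $q_{u,i}\ge0$, $r_{u,i}\ge r_{l,i}>0$ and $\vartheta_{l,i},\vartheta_{u,i}>0$ with $$0\le Q_i(k)\le q_{u,i}I,\qquad r_{l,i}I\le R_i(k+1)\le r_{u,i}I,\qquad \vartheta_{l,i}\le|\vartheta_i(k)|\le\vartheta_{u,i}\qquad\text{for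 all }k\ge0.$$ Then there is a constant $a>0$ such that, for all coupling blocks $A_{ij}(k)$, $i\ne j$, with $\|A_{ij}(k)\|\le a$ for all $i\neq j$ and $k\ge0$, the following holds: if $\big(C_i(k),\sqrt2\,\vartheta_i(k)A_{ii}(k)\big)$ is uniformly detectable for every $i=1,\dots,s$, then for every initial condition $P(0)=\mathrm{Diag}(P_1(0),\dots,P_s(0))\ge0$ the solution $\{P(k)\}_{k\ge0}$ of the DMRE is uniformly bounded from above, i.e. there is $p\ge0$ with $P(k)\le pI$ for all $k\ge0$. -/

import Mathlib

-- Makes `‖M‖` the 2-norm (spectral norm) of a real matrix `M`.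
open scoped Matrix.Norms.L2Operator

namespace InterconnectedSystem

noncomputable section

open Matrix

/-- The transition matrix `Φ_X(k + t, k) = X(k + t - 1) ⋯ X(k)`, with `Φ_X(k, k) = I`. -/
def transition {p : ℕ} (X : ℕ → Matrix (Fin p) (Fin p) ℝ) (k : ℕ) :
    ℕ → Matrix (Fin p) (Fin p) ℝ
  | 0 => 1
  | t + 1 => X (k + t) * transition X k t

/-- Uniform detectability of a time-varying pair `(Y(k), X(k))`. The times are `k ≥ 1`, because
measurement matrices exist only from time `1` on (the value of `Y` at `0` is immaterial). -/
def UniformlyDetectable {p q : ℕ} (Y : ℕ → Matrix (Fin q) (Fin p) ℝ)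
    (X : ℕ → Matrix (Fin p) (Fin p) ℝ) : Prop :=
  ∃ (μ ν : ℕ) (γ σ : ℝ), μ ≤ ν ∧ 0 ≤ γ ∧ γ < 1 ∧ 0 < σ ∧
    ∀ (k : ℕ), 1 ≤ k → ∀ ξ : Fin p → ℝ,
      γ * ‖WithLp.toLp 2 ξ‖ ≤ ‖WithLp.toLp 2 (transition X k μ *ᵥ ξ)‖ →
      σ * ‖WithLp.toLp 2 ξ‖ ^ 2 ≤
        ξ ⬝ᵥ ((∑ i ∈ Finset.range (ν + 1),
          (transition X k i)ᵀ * (Y (k + i))ᵀ * Y (k + i) * transition X k i) *ᵥ ξ)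

variable {s : ℕ} {n m : Fin s → ℕ}

open Classical in
/-- The in-neighbours of subsystem `i`, for the blocks `A i j` at a fixed time:
all `j ≠ i` with `A i j ≠ 0`. -/
def inNeighbours (A : ∀ i j : Fin s, Matrix (Fin (n i)) (Fin (n j)) ℝ) (i : Fin s) :
    Finset (Fin s) :=
  Finset.univ.filter fun j => j ≠ i ∧ A i j ≠ 0

/-- Prediction step: `ϑ_i² ∑_{j ∈ 𝕀_i ∪ {i}} A_ij P_j A_ijᵀ + Q_i`. -/
def predict (A : ∀ i j : Fin s, Matrix (Fin (n i)) (Fin (n j)) ℝ) (θ : Fin s → ℝ)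
    (Q : ∀ i : Fin s, Matrix (Fin (n i)) (Fin (n i)) ℝ)
    (P : ∀ i : Fin s, Matrix (Fin (n i)) (Fin (n i)) ℝ) (i : Fin s) :
    Matrix (Fin (n i)) (Fin (n i)) ℝ :=
  (θ i) ^ 2 • (∑ j ∈ insert i (inNeighbours A i), A i j * P j * (A i j)ᵀ) + Q i

/-- Update step: `P̄ - P̄ Cᵀ (C P̄ Cᵀ + R)⁻¹ C P̄`. -/
def update {p q : ℕ} (C : Matrix (Fin q) (Fin p) ℝ) (R : Matrix (Fin q) (Fin q) ℝ)
    (Pbar : Matrix (Fin p) (Fin p) ℝ) : Matrix (Fin p) (Fin p) ℝ :=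
  Pbar - Pbar * Cᵀ * (C * Pbar * Cᵀ + R)⁻¹ * C * Pbar

/-- The blocks `P_i(k)` of the solution of the distributed modified Riccati equation with initial
blocks `P_i(0) = P0 i`:
`P̄_i(k+1) = ϑ_i(k)² ∑_{j ∈ 𝕀_i(k) ∪ {i}} A_ij(k) P_j(k) A_ij(k)ᵀ + Q_i(k)`, and `P_i(k+1)` is the
update of `P̄_i(k+1)` with `C_i(k+1)` and `R_i(k+1)`. -/
def dmre (A : ℕ → ∀ i j : Fin s, Matrix (Fin (n i)) (Fin (n j)) ℝ)
    (C : ℕ → ∀ i : Fin s, Matrix (Fin (m i)) (Fin (n i)) ℝ)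
    (θ : ℕ → Fin s → ℝ)
    (Q : ℕ → ∀ i : Fin s, Matrix (Fin (n i)) (Fin (n i)) ℝ)
    (R : ℕ → ∀ i : Fin s, Matrix (Fin (m i)) (Fin (m i)) ℝ)
    (P0 : ∀ i : Fin s, Matrix (Fin (n i)) (Fin (n i)) ℝ) :
    ℕ → ∀ i : Fin s, Matrix (Fin (n i)) (Fin (n i)) ℝ
  | 0 => P0
  | k + 1 => fun i =>
      update (C (k + 1) i) (R (k + 1) i) (predict (A k) (θ k) (Q k) (dmre A C θ Q R P0 k) i)

end

end InterconnectedSystem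

/-!
The idea is to dominate the predicted covariances `P̄ᵢ(k)` of the coupled recursion by a fixed
multiple of a bounded comparison sequence that depends on the local data of subsystem `i` only.

For the comparison sequence take the decoupled Riccati solution `Vᵢ` of the pair
`(Cᵢ, √2 ϑᵢ Aᵢᵢ)` with unit noise weights (`riccati`). It satisfies
`Vᵢ(k+1) = F Vᵢ(k) Fᵀ + L Lᵀ + I` with `F = √2 ϑᵢ Aᵢᵢ - L Cᵢ`, where `L` is its optimal gain.
Two facts carry the proof.

*Detectability bounds `Vᵢ`* (`UniformlyDetectable.exists_riccati_bound`). Put `X = √2 ϑᵢ Aᵢᵢ`. Every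
vector `V(K) η` is the end point of a trajectory `x(k+1) = X(k) x(k) + w(k)` whose initial state,
disturbances `w(k)` and outputs `Cᵢ(k) x(k)` all have squared norm at most `r² = ηᵀ V(K) η`: run the
costate `η` backwards through `Fᵀ` and add up the energies (`exists_trajectory_riccati`). On the
other hand, for such a trajectory detectability gives `‖x(k+μ)‖ ≤ γ ‖x(k)‖ + const · r`: either the
undisturbed flow contracts `x(k)`, or the outputs on the window of length `ν` bound `x(k)`. Looking
at the time of the largest state yields `‖x(K)‖ ≤ κ r`
(`UniformlyDetectable.exists_state_bound`). Hence `r² ≤ ‖η‖ ‖V(K) η‖ ≤ κ r ‖η‖`, that is,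
`V(K) ≤ κ² I`.

*The measurement update is optimal among all gains* (`quad_update_le`). Using the gain `L` of `Vᵢ` in
the coupled recursion, the estimate `P̄ᵢ(k) ≤ c Vᵢ(k)` is inherited by time `k + 1` as soon as
`c (L Lᵀ + I)` dominates `L Rᵢ Lᵀ + Qᵢ` plus the coupling terms. The latter are of order `c a²`, so
they are at most `c / 2` times the identity for small `a`, whatever `c` is; therefore `a` can be
fixed before `c`, which has to depend on the initial condition.
-/

namespace InterconnectedSystem

open Matrix

/-! ### Quadratic forms and the Euclidean norm -/

/-- The quadratic form `xᵀ M x` of a real matrix. -/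
def quad {ι : Type*} [Fintype ι] (M : Matrix ι ι ℝ) (x : ι → ℝ) : ℝ := x ⬝ᵥ (M *ᵥ x)

section Quad

variable {ι κ : Type*} [Fintype ι] [Fintype κ]

theorem quad_add (M N : Matrix ι ι ℝ) (x : ι → ℝ) :
    quad (M + N) x = quad M x + quad N x := by
  simp [quad, add_mulVec]

theorem quad_sub (M N : Matrix ι ι ℝ) (x : ι → ℝ) :
    quad (M - N) x = quad M x - quad N x := by
  simp [quad, sub_mulVec]

theorem quad_smul (c : ℝ) (M : Matrix ι ι ℝ) (x : ι → ℝ) :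
    quad (c • M) x = c * quad M x := by
  simp [quad, smul_mulVec]

theorem quad_sum {α : Type*} (S : Finset α) (M : α → Matrix ι ι ℝ) (x : ι → ℝ) :
    quad (∑ a ∈ S, M a) x = ∑ a ∈ S, quad (M a) x := by
  simp [quad, sum_mulVec, dotProduct_sum]

theorem quad_conj (B : Matrix ι κ ℝ) (M : Matrix κ κ ℝ) (x : ι → ℝ) :
    quad (B * M * Bᵀ) x = quad M (Bᵀ *ᵥ x) := by
  simp only [quad, ← mulVec_mulVec, dotProduct_mulVec x B, ← mulVec_transpose]

theorem norm_toLp_sq (x : ι → ℝ) : ‖WithLp.toLp 2 x‖ ^ 2 = x ⬝ᵥ x := by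
  rw [EuclideanSpace.norm_sq_eq]
  simp [dotProduct, sq]

theorem quad_one [DecidableEq ι] (x : ι → ℝ) :
    quad (1 : Matrix ι ι ℝ) x = ‖WithLp.toLp 2 x‖ ^ 2 := by
  simp [quad, norm_toLp_sq]

theorem quad_smul_one [DecidableEq ι] (c : ℝ) (x : ι → ℝ) :
    quad (c • (1 : Matrix ι ι ℝ)) x = c * ‖WithLp.toLp 2 x‖ ^ 2 := by
  rw [quad_smul, quad_one]

theorem quad_nonneg {M : Matrix ι ι ℝ} (hM : M.PosSemidef) (x : ι → ℝ) : 0 ≤ quad M x := by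
  simpa [quad] using hM.dotProduct_mulVec_nonneg x

theorem dotProduct_le_norm_mul_norm (x y : ι → ℝ) :
    x ⬝ᵥ y ≤ ‖WithLp.toLp 2 x‖ * ‖WithLp.toLp 2 y‖ := by
  have h := real_inner_le_norm (WithLp.toLp 2 y : EuclideanSpace ℝ ι) (WithLp.toLp 2 x)
  rw [EuclideanSpace.inner_toLp_toLp] at h
  simpa [mul_comm] using h

theorem norm_mulVec_le [DecidableEq κ] (M : Matrix ι κ ℝ) (x : κ → ℝ) :
    ‖WithLp.toLp 2 (M *ᵥ x)‖ ≤ ‖M‖ * ‖WithLp.toLp 2 x‖ :=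
  l2_opNorm_mulVec M (WithLp.toLp 2 x)

theorem norm_transpose_eq [DecidableEq ι] [DecidableEq κ] (M : Matrix ι κ ℝ) : ‖Mᵀ‖ = ‖M‖ := by
  rw [← l2_opNorm_conjTranspose M, conjTranspose_eq_transpose_of_trivial]

theorem quad_le_norm_mul [DecidableEq ι] (M : Matrix ι ι ℝ) (x : ι → ℝ) :
    quad M x ≤ ‖M‖ * ‖WithLp.toLp 2 x‖ ^ 2 := by
  have h := dotProduct_le_norm_mul_norm x (M *ᵥ x)
  have h' := norm_mulVec_le M x
  calc quad M x ≤ ‖WithLp.toLp 2 x‖ * ‖WithLp.toLp 2 (M *ᵥ x)‖ := h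
    _ ≤ ‖WithLp.toLp 2 x‖ * (‖M‖ * ‖WithLp.toLp 2 x‖) := by gcongr
    _ = _ := by ring

theorem posSemidef_conj {M : Matrix κ κ ℝ} (hM : M.PosSemidef) (B : Matrix ι κ ℝ) :
    (B * M * Bᵀ).PosSemidef := by
  simpa using hM.mul_mul_conjTranspose_same B

theorem posSemidef_smul_one_sub [DecidableEq ι] {M : Matrix ι ι ℝ} (hM : M.PosSemidef) {c : ℝ}
    (h : ∀ x, quad M x ≤ c * ‖WithLp.toLp 2 x‖ ^ 2) :
    (c • (1 : Matrix ι ι ℝ) - M).PosSemidef := by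
  refine PosSemidef.of_dotProduct_mulVec_nonneg ?_ fun x => ?_
  · refine IsHermitian.sub ?_ hM.isHermitian
    simp [IsHermitian]
  · have := h x
    rw [← quad_smul_one, ← sub_nonneg, ← quad_sub] at this
    simpa [quad] using this

end Quad

/-- The block-diagonal matrix inherits a common quadratic-form bound of its blocks. -/
theorem quad_blockDiagonal'_le {s : ℕ} {n : Fin s → ℕ}
    (P : ∀ i, Matrix (Fin (n i)) (Fin (n i)) ℝ) {c : ℝ}
    (h : ∀ i x, quad (P i) x ≤ c * ‖WithLp.toLp 2 x‖ ^ 2) (x : ((i : Fin s) × Fin (n i)) → ℝ) :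
    quad (blockDiagonal' P) x ≤ c * ‖WithLp.toLp 2 x‖ ^ 2 := by
  have e1 : quad (blockDiagonal' P) x = ∑ i, quad (P i) (fun u => x ⟨i, u⟩) := by
    simp only [quad, dotProduct, Fintype.sum_sigma]
    refine Finset.sum_congr rfl fun i _ => Finset.sum_congr rfl fun u _ => ?_
    congr 1
    simp only [mulVec, dotProduct, Fintype.sum_sigma]
    rw [Finset.sum_eq_single i]
    · simp
    · intro j _ hj
      exact Finset.sum_eq_zero fun v _ => by rw [blockDiagonal'_apply_ne _ _ _ hj.symm, zero_mul]
    · simp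
  have e2 : ‖WithLp.toLp 2 x‖ ^ 2 = ∑ i, ‖WithLp.toLp 2 (fun u => x ⟨i, u⟩)‖ ^ 2 := by
    simp only [norm_toLp_sq, dotProduct, Fintype.sum_sigma]
  rw [e1, e2, Finset.mul_sum]
  exact Finset.sum_le_sum fun i _ => h i _

theorem posSemidef_blockDiagonal' {s : ℕ} {n : Fin s → ℕ}
    {P : ∀ i, Matrix (Fin (n i)) (Fin (n i)) ℝ} (h : ∀ i, (P i).PosSemidef) :
    (blockDiagonal' P).PosSemidef := by
  refine PosSemidef.of_dotProduct_mulVec_nonneg ?_ fun x => ?_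
  · exact isHermitian_blockDiagonal'_iff.2 fun i => (h i).isHermitian
  · -- the upper bound for `-P`, with constant `0`
    have := quad_blockDiagonal'_le (fun i => -P i) (c := 0)
      (fun i y => by
        have := quad_nonneg (h i) y
        simp only [quad, neg_mulVec, dotProduct_neg] at this ⊢
        linarith) x
    rw [show (fun i => -P i) = -P from rfl, blockDiagonal'_neg] at this
    simp only [quad, neg_mulVec, dotProduct_neg, star_trivial] at this ⊢
    linarith

/-! ### The measurement update as an optimal linear correction -/

section Update

variable {p q : ℕ}

/-- The gain `X P̄ Cᵀ (C P̄ Cᵀ + R)⁻¹` minimising `(X - L C) P̄ (X - L C)ᵀ + L R Lᵀ` over `L`. -/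
noncomputable def gain (C : Matrix (Fin q) (Fin p) ℝ) (R : Matrix (Fin q) (Fin q) ℝ)
    (Pbar X : Matrix (Fin p) (Fin p) ℝ) : Matrix (Fin p) (Fin q) ℝ :=
  X * (Pbar * Cᵀ * (C * Pbar * Cᵀ + R)⁻¹)

theorem posDef_innovation (C : Matrix (Fin q) (Fin p) ℝ) {R : Matrix (Fin q) (Fin q) ℝ}
    {Pbar : Matrix (Fin p) (Fin p) ℝ} (hR : R.PosDef) (hP : Pbar.PosSemidef) :
    (C * Pbar * Cᵀ + R).PosDef :=
  PosDef.posSemidef_add (posSemidef_conj hP C) hR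

/-- Completion of squares in the gain `L`. -/
theorem joseph_form (C : Matrix (Fin q) (Fin p) ℝ) {R : Matrix (Fin q) (Fin q) ℝ}
    {Pbar : Matrix (Fin p) (Fin p) ℝ} (hR : R.PosDef) (hP : Pbar.PosSemidef)
    (X : Matrix (Fin p) (Fin p) ℝ) (L : Matrix (Fin p) (Fin q) ℝ) :
    (X - L * C) * Pbar * (X - L * C)ᵀ + L * R * Lᵀ =
      X * update C R Pbar * Xᵀ +
        (L - gain C R Pbar X) * (C * Pbar * Cᵀ + R) * (L - gain C R Pbar X)ᵀ := by
  have hS := posDef_innovation C hR hP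
  have hPt : Pbarᵀ = Pbar := by simpa using hP.isHermitian.eq
  have hSt : (C * Pbar * Cᵀ + R)ᵀ = C * Pbar * Cᵀ + R := by simpa using hS.isHermitian.eq
  have hu := (isUnit_iff_isUnit_det _).1 hS.isUnit
  unfold gain update
  generalize hSd : C * Pbar * Cᵀ + R = S at *
  obtain rfl : R = S - C * Pbar * Cᵀ := by rw [← hSd]; abel
  have h1 : S * S⁻¹ = 1 := mul_nonsing_inv _ hu
  have h2 : S⁻¹ * S = 1 := nonsing_inv_mul _ hu
  have h3 : ∀ Y : Matrix (Fin q) (Fin p) ℝ, S * (S⁻¹ * Y) = Y := fun Y => by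
    rw [← Matrix.mul_assoc, h1, Matrix.one_mul]
  have h4 : ∀ Y : Matrix (Fin q) (Fin p) ℝ, S⁻¹ * (S * Y) = Y := fun Y => by
    rw [← Matrix.mul_assoc, h2, Matrix.one_mul]
  simp only [transpose_sub, transpose_mul, transpose_transpose, transpose_nonsing_inv, hPt, hSt,
    Matrix.mul_sub, Matrix.sub_mul, Matrix.mul_assoc, h3, h4]
  abel

theorem quad_update_le (C : Matrix (Fin q) (Fin p) ℝ) {R : Matrix (Fin q) (Fin q) ℝ}
    {Pbar : Matrix (Fin p) (Fin p) ℝ} (hR : R.PosDef) (hP : Pbar.PosSemidef)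
    (X : Matrix (Fin p) (Fin p) ℝ) (L : Matrix (Fin p) (Fin q) ℝ) (x : Fin p → ℝ) :
    quad (update C R Pbar) (Xᵀ *ᵥ x) ≤
      quad Pbar ((X - L * C)ᵀ *ᵥ x) + quad R (Lᵀ *ᵥ x) := by
  have h := congrArg (quad · x) (joseph_form C hR hP X L)
  simp only [quad_add (_ * _ * _) (_ * _ * _), quad_conj] at h
  linarith [quad_nonneg (posDef_innovation C hR hP).posSemidef
    ((L - gain C R Pbar X)ᵀ *ᵥ x)]

theorem conj_update_eq (C : Matrix (Fin q) (Fin p) ℝ) {R : Matrix (Fin q) (Fin q) ℝ}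
    {Pbar : Matrix (Fin p) (Fin p) ℝ} (hR : R.PosDef) (hP : Pbar.PosSemidef)
    (X : Matrix (Fin p) (Fin p) ℝ) :
    X * update C R Pbar * Xᵀ =
      (X - gain C R Pbar X * C) * Pbar * (X - gain C R Pbar X * C)ᵀ +
        gain C R Pbar X * R * (gain C R Pbar X)ᵀ := by
  rw [joseph_form C hR hP X (gain C R Pbar X)]
  simp

theorem posSemidef_update (C : Matrix (Fin q) (Fin p) ℝ) {R : Matrix (Fin q) (Fin q) ℝ}
    {Pbar : Matrix (Fin p) (Fin p) ℝ} (hR : R.PosDef) (hP : Pbar.PosSemidef) :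
    (update C R Pbar).PosSemidef := by
  have h := conj_update_eq C hR hP 1
  rw [transpose_one, Matrix.mul_one, Matrix.one_mul] at h
  rw [h]
  exact (posSemidef_conj hP _).add (posSemidef_conj hR.posSemidef _)

theorem quad_update_le_self (C : Matrix (Fin q) (Fin p) ℝ) {R : Matrix (Fin q) (Fin q) ℝ}
    {Pbar : Matrix (Fin p) (Fin p) ℝ} (hR : R.PosDef) (hP : Pbar.PosSemidef) (x : Fin p → ℝ) :
    quad (update C R Pbar) x ≤ quad Pbar x := by
  simpa [quad] using quad_update_le C hR hP 1 0 x

end Update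

/-! ### State estimates from uniform detectability -/

section Detectability

variable {p q : ℕ} {X : ℕ → Matrix (Fin p) (Fin p) ℝ} {Y : ℕ → Matrix (Fin q) (Fin p) ℝ}
  {x : ℕ → Fin p → ℝ} {b d : ℝ} {K : ℕ}

theorem transition_shift (X : ℕ → Matrix (Fin p) (Fin p) ℝ) (k t : ℕ) :
    transition (fun k => X (k + 1)) k t = transition X (k + 1) t := by
  induction t with
  | zero => rfl
  | succ t ih => simp only [transition, ih, Nat.add_right_comm k t 1]

theorem norm_transition_mulVec_le (hb : 0 ≤ b) (hX : ∀ k, ‖X k‖ ≤ b) (k t : ℕ) (ξ : Fin p → ℝ) :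
    ‖WithLp.toLp 2 (transition X k t *ᵥ ξ)‖ ≤ b ^ t * ‖WithLp.toLp 2 ξ‖ := by
  induction t with
  | zero => simp [transition]
  | succ t ih =>
    rw [transition, ← mulVec_mulVec]
    calc _ ≤ ‖X (k + t)‖ * ‖WithLp.toLp 2 (transition X k t *ᵥ ξ)‖ := norm_mulVec_le _ _
      _ ≤ b * (b ^ t * ‖WithLp.toLp 2 ξ‖) := by gcongr; exact hX _
      _ = _ := by ring

/-- A trajectory with disturbances of size at most `d` stays close to the undisturbed one. -/
theorem norm_sub_transition_le (hb : 1 ≤ b) (hX : ∀ k, ‖X k‖ ≤ b) (hd : 0 ≤ d)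
    (hw : ∀ k < K, ‖WithLp.toLp 2 (x (k + 1) - X k *ᵥ x k)‖ ≤ d) (k t : ℕ) (hK : k + t ≤ K) :
    ‖WithLp.toLp 2 (x (k + t) - transition X k t *ᵥ x k)‖ ≤ b ^ t * t * d := by
  induction t with
  | zero => simp [transition]
  | succ t ih =>
    have h1 := ih (by omega)
    have h2 := hw (k + t) (by omega)
    have e : x (k + (t + 1)) - transition X k (t + 1) *ᵥ x k =
        (x (k + t + 1) - X (k + t) *ᵥ x (k + t)) +
          X (k + t) *ᵥ (x (k + t) - transition X k t *ᵥ x k) := by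
      rw [transition, ← mulVec_mulVec, mulVec_sub, ← add_assoc]
      abel
    rw [e, WithLp.toLp_add]
    have h3 : 1 ≤ b ^ (t + 1) := one_le_pow₀ hb
    calc _ ≤ d + ‖X (k + t)‖ * ‖WithLp.toLp 2 (x (k + t) - transition X k t *ᵥ x k)‖ :=
          (norm_add_le _ _).trans (add_le_add h2 (norm_mulVec_le _ _))
      _ ≤ b ^ (t + 1) * d + b * (b ^ t * t * d) := by
          gcongr
          · exact le_mul_of_one_le_left hd h3
          · exact hX _
      _ = _ := by push_cast; ring

theorem norm_le_of_disturbance_le (hb : 1 ≤ b) (hX : ∀ k, ‖X k‖ ≤ b) (hd : 0 ≤ d)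
    (hw : ∀ k < K, ‖WithLp.toLp 2 (x (k + 1) - X k *ᵥ x k)‖ ≤ d) (k t : ℕ) (hK : k + t ≤ K) :
    ‖WithLp.toLp 2 (x (k + t))‖ ≤ b ^ t * (‖WithLp.toLp 2 (x k)‖ + t * d) := by
  have h1 := norm_sub_transition_le hb hX hd hw k t hK
  have h2 := norm_transition_mulVec_le (zero_le_one.trans hb) hX k t (x k)
  rw [WithLp.toLp_sub] at h1
  have h3 := norm_le_norm_add_norm_sub (WithLp.toLp 2 (transition X k t *ᵥ x k))
    (WithLp.toLp 2 (x (k + t)))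
  rw [norm_sub_rev] at h3
  linarith

theorem quad_gramian (X : ℕ → Matrix (Fin p) (Fin p) ℝ) (Y : ℕ → Matrix (Fin q) (Fin p) ℝ)
    (k ν : ℕ) (ξ : Fin p → ℝ) :
    ξ ⬝ᵥ ((∑ i ∈ Finset.range (ν + 1),
      (transition X k i)ᵀ * (Y (k + i))ᵀ * Y (k + i) * transition X k i) *ᵥ ξ) =
    ∑ i ∈ Finset.range (ν + 1), ‖WithLp.toLp 2 (Y (k + i) *ᵥ (transition X k i *ᵥ ξ))‖ ^ 2 := by
  rw [sum_mulVec, dotProduct_sum]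
  refine Finset.sum_congr rfl fun i _ => ?_
  rw [norm_toLp_sq, Matrix.mul_assoc, ← transpose_mul, ← mulVec_mulVec, dotProduct_mulVec,
    vecMul_transpose, mulVec_mulVec]

/-- Uniform detectability makes the state of a disturbed system bounded by the size `d` of the
initial state, the disturbances and the outputs. -/
theorem UniformlyDetectable.exists_state_bound (h : UniformlyDetectable Y X) {β : ℝ}
    (hX : ∀ k, ‖X (k + 1)‖ ≤ b) (hY : ∀ k, ‖Y (k + 1)‖ ≤ β) :
    ∃ c : ℝ, 0 ≤ c ∧ ∀ (K : ℕ) (d : ℝ) (x : ℕ → Fin p → ℝ), 0 ≤ d →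
      ‖WithLp.toLp 2 (x 0)‖ ≤ d →
      (∀ k < K, ‖WithLp.toLp 2 (x (k + 1) - X (k + 1) *ᵥ x k)‖ ≤ d) →
      (∀ k < K, ‖WithLp.toLp 2 (Y (k + 1) *ᵥ x k)‖ ≤ d) →
      ‖WithLp.toLp 2 (x K)‖ ≤ c * d := by
  wlog hb : 1 ≤ b generalizing b
  · exact this (b := 1) (fun k => (hX k).trans (not_le.1 hb).le) le_rfl
  obtain ⟨μ, ν, γ, σ, hμν, hγ0, hγ1, hσ, hdet⟩ := h
  have hb0 : 0 ≤ b := zero_le_one.trans hb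
  have hβ : 0 ≤ β := (norm_nonneg _).trans (hY 0)
  -- `κ d` bounds the states at which the observability Gramian is large
  set H : ℝ := ∑ i ∈ Finset.range (ν + 1), (1 + β * (b ^ i * i)) ^ 2 with hH
  have hH0 : 0 ≤ H := Finset.sum_nonneg fun i _ => sq_nonneg _
  set κ : ℝ := Real.sqrt (H / σ) with hκ
  have hκ0 : 0 ≤ κ := Real.sqrt_nonneg _
  have hκ2 : σ * κ ^ 2 = H := by
    rw [hκ, Real.sq_sqrt (by positivity)]; field_simp
  set M : ℝ := b ^ μ * (κ + μ) / (1 - γ) + b ^ μ * (1 + μ) with hM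
  have hγ' : 0 < 1 - γ := by linarith
  have hM0 : 0 ≤ M := by positivity
  refine ⟨b ^ (ν + 1) * (M + 1 + (ν + 1)), by positivity, fun K d x hd hx0 hw hy => ?_⟩
  have grow := norm_le_of_disturbance_le (X := fun k => X (k + 1)) hb hX hd hw
  have step : ∀ k, k + ν < K → ‖WithLp.toLp 2 (x (k + μ))‖ ≤
      γ * ‖WithLp.toLp 2 (x k)‖ + b ^ μ * (κ + μ) * d := by
    intro k hk
    have err := norm_sub_transition_le (X := fun k => X (k + 1)) hb hX hd hw k
    by_cases hcase : γ * ‖WithLp.toLp 2 (x k)‖ ≤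
        ‖WithLp.toLp 2 (transition X (k + 1) μ *ᵥ x k)‖
    · have hg := hdet (k + 1) (by omega) (x k) hcase
      rw [quad_gramian] at hg
      have hsum : ∑ i ∈ Finset.range (ν + 1),
          ‖WithLp.toLp 2 (Y (k + 1 + i) *ᵥ (transition X (k + 1) i *ᵥ x k))‖ ^ 2 ≤ H * d ^ 2 := by
        rw [hH, Finset.sum_mul]
        refine Finset.sum_le_sum fun i hi => ?_
        have hi' : i ≤ ν := Nat.lt_succ_iff.1 (Finset.mem_range.1 hi)
        have h1 := err i (by omega)
        rw [transition_shift] at h1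
        have h2 := hy (k + i) (by omega)
        have h3 := hY (k + i)
        rw [show k + i + 1 = k + 1 + i by omega] at h2 h3
        rw [← mul_pow]
        refine pow_le_pow_left₀ (norm_nonneg _) ?_ 2
        have e : Y (k + 1 + i) *ᵥ (transition X (k + 1) i *ᵥ x k) = Y (k + 1 + i) *ᵥ x (k + i) -
            Y (k + 1 + i) *ᵥ (x (k + i) - transition X (k + 1) i *ᵥ x k) := by
          rw [mulVec_sub]; abel
        rw [e, WithLp.toLp_sub]
        calc _ ≤ d + ‖Y (k + 1 + i)‖ *
                ‖WithLp.toLp 2 (x (k + i) - transition X (k + 1) i *ᵥ x k)‖ :=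
              (norm_sub_le _ _).trans (add_le_add h2 (norm_mulVec_le _ _))
          _ ≤ d + β * (b ^ i * i * d) := by gcongr
          _ = _ := by ring
      have hxk : ‖WithLp.toLp 2 (x k)‖ ≤ κ * d := by
        refine le_of_sq_le_sq ?_ (by positivity)
        refine le_of_mul_le_mul_left ?_ hσ
        calc _ ≤ H * d ^ 2 := hg.trans hsum
          _ = _ := by rw [← hκ2]; ring
      have h1 := grow k μ (by omega)
      calc _ ≤ b ^ μ * (‖WithLp.toLp 2 (x k)‖ + μ * d) := h1
        _ ≤ b ^ μ * (κ * d + μ * d) := by gcongr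
        _ = b ^ μ * (κ + μ) * d := by ring
        _ ≤ _ := le_add_of_nonneg_left (by positivity)
    · have h1 := err μ (by omega)
      rw [transition_shift, WithLp.toLp_sub] at h1
      have h3 := norm_le_norm_add_norm_sub (WithLp.toLp 2 (transition X (k + 1) μ *ᵥ x k))
        (WithLp.toLp 2 (x (k + μ)))
      rw [norm_sub_rev] at h3
      have h4 : 0 ≤ b ^ μ * κ * d := by positivity
      linarith
  rcases Nat.lt_or_ge ν K with hK | hK
  · -- the largest state at times whose observation window ends before `K`
    obtain ⟨t, ht, hmax⟩ := Finset.exists_max_image (Finset.range (K - ν))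
      (fun t => ‖WithLp.toLp 2 (x t)‖) ⟨0, Finset.mem_range.2 (by omega)⟩
    have ht' := Finset.mem_range.1 ht
    have hxt : ‖WithLp.toLp 2 (x t)‖ ≤ M * d := by
      rw [hM, add_mul]
      rcases Nat.lt_or_ge t μ with htμ | htμ
      · have h1 := grow 0 t (by omega)
        rw [zero_add] at h1
        have h2 : (t : ℝ) ≤ μ := by exact_mod_cast htμ.le
        have h3 : b ^ t ≤ b ^ μ := pow_le_pow_right₀ hb htμ.le
        calc _ ≤ b ^ t * (‖WithLp.toLp 2 (x 0)‖ + t * d) := h1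
          _ ≤ b ^ μ * (d + μ * d) := by gcongr
          _ = b ^ μ * (1 + μ) * d := by ring
          _ ≤ _ := le_add_of_nonneg_left (by positivity)
      · have h1 := step (t - μ) (by omega)
        rw [Nat.sub_add_cancel htμ] at h1
        have h2 := hmax (t - μ) (Finset.mem_range.2 (by omega))
        have h3 : (1 - γ) * ‖WithLp.toLp 2 (x t)‖ ≤ b ^ μ * (κ + μ) * d := by
          have := mul_le_mul_of_nonneg_left h2 hγ0
          linarith
        have h4 : ‖WithLp.toLp 2 (x t)‖ ≤ b ^ μ * (κ + μ) / (1 - γ) * d := by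
          rw [div_mul_eq_mul_div, le_div_iff₀ hγ']
          linarith
        exact h4.trans (le_add_of_nonneg_right (by positivity))
    have h1 := grow (K - ν - 1) (ν + 1) (by omega)
    rw [show K - ν - 1 + (ν + 1) = K by omega] at h1
    have h2 := (hmax (K - ν - 1) (Finset.mem_range.2 (by omega))).trans hxt
    push_cast at h1
    calc _ ≤ b ^ (ν + 1) * (‖WithLp.toLp 2 (x (K - ν - 1))‖ + (ν + 1) * d) := h1
      _ ≤ b ^ (ν + 1) * ((M + 1) * d + (ν + 1) * d) := by gcongr; linarith
      _ = _ := by ring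
  · have h1 := grow 0 K (by omega)
    rw [zero_add] at h1
    have h2 : (K : ℝ) ≤ ν + 1 := by exact_mod_cast hK.trans (Nat.le_succ ν)
    have h3 : b ^ K ≤ b ^ (ν + 1) := pow_le_pow_right₀ hb (by omega)
    calc _ ≤ b ^ K * (‖WithLp.toLp 2 (x 0)‖ + K * d) := h1
      _ ≤ b ^ (ν + 1) * ((M + 1) * d + (ν + 1) * d) := by
        gcongr
        nlinarith
      _ = _ := by ring

end Detectability

/-! ### A bounded Riccati solution for a detectable pair -/

section Riccati

variable {p q : ℕ}

/-- The predicted covariance of the Kalman filter with unit noise weights and unit initial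
covariance. The value at index `k` belongs to time `k + 1`, since `Y` matters from time `1` on. -/
noncomputable def riccati (Y : ℕ → Matrix (Fin q) (Fin p) ℝ)
    (X : ℕ → Matrix (Fin p) (Fin p) ℝ) : ℕ → Matrix (Fin p) (Fin p) ℝ
  | 0 => 1
  | k + 1 => X (k + 1) * update (Y (k + 1)) 1 (riccati Y X k) * (X (k + 1))ᵀ + 1

variable (Y : ℕ → Matrix (Fin q) (Fin p) ℝ) (X : ℕ → Matrix (Fin p) (Fin p) ℝ)

theorem posSemidef_riccati (k : ℕ) : (riccati Y X k).PosSemidef := by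
  induction k with
  | zero => exact PosSemidef.one
  | succ k ih => exact (posSemidef_conj (posSemidef_update _ PosDef.one ih) _).add PosSemidef.one

/-- The Kalman gain belonging to `riccati`, with the same index convention. -/
noncomputable def riccatiGain (k : ℕ) : Matrix (Fin p) (Fin q) ℝ :=
  gain (Y (k + 1)) 1 (riccati Y X k) (X (k + 1))

theorem riccati_succ (k : ℕ) :
    riccati Y X (k + 1) =
      (X (k + 1) - riccatiGain Y X k * Y (k + 1)) * riccati Y X k *
        (X (k + 1) - riccatiGain Y X k * Y (k + 1))ᵀ +
      riccatiGain Y X k * (1 : Matrix (Fin q) (Fin q) ℝ) * (riccatiGain Y X k)ᵀ + 1 := by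
  rw [riccati, conj_update_eq _ PosDef.one (posSemidef_riccati Y X k)]
  rfl

theorem quad_riccati_succ (k : ℕ) (η : Fin p → ℝ) :
    quad (riccati Y X (k + 1)) η =
      quad (riccati Y X k) ((X (k + 1) - riccatiGain Y X k * Y (k + 1))ᵀ *ᵥ η) +
      ‖WithLp.toLp 2 ((riccatiGain Y X k)ᵀ *ᵥ η)‖ ^ 2 + ‖WithLp.toLp 2 η‖ ^ 2 := by
  rw [riccati_succ, quad_add, quad_add, quad_conj, quad_conj, quad_one, quad_one]

/-- The output along the optimal trajectory equals the gain applied to the costate. -/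
theorem output_riccati (k : ℕ) :
    Y (k + 1) * riccati Y X k * (X (k + 1) - riccatiGain Y X k * Y (k + 1))ᵀ =
      (riccatiGain Y X k)ᵀ := by
  have hP := posSemidef_riccati Y X k
  have hS := posDef_innovation (Y (k + 1)) PosDef.one hP
  have hPt : (riccati Y X k)ᵀ = riccati Y X k := by simpa using hP.isHermitian.eq
  have hSt : (Y (k + 1) * riccati Y X k * (Y (k + 1))ᵀ + 1)ᵀ =
    Y (k + 1) * riccati Y X k * (Y (k + 1))ᵀ + 1 := by simpa using hS.isHermitian.eq
  have h1 := mul_nonsing_inv _ ((isUnit_iff_isUnit_det _).1 hS.isUnit)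
  have hG : (riccatiGain Y X k)ᵀ = (Y (k + 1) * riccati Y X k * (Y (k + 1))ᵀ + 1)⁻¹ *
      (Y (k + 1) * riccati Y X k * (X (k + 1))ᵀ) := by
    rw [riccatiGain, gain, transpose_mul, transpose_mul, transpose_mul, transpose_nonsing_inv, hSt,
      hPt, transpose_transpose]
    simp only [Matrix.mul_assoc]
  rw [transpose_sub, transpose_mul, Matrix.mul_sub, hG]
  generalize hV : Y (k + 1) * riccati Y X k * (X (k + 1))ᵀ = V
  generalize hSd : Y (k + 1) * riccati Y X k * (Y (k + 1))ᵀ = W at h1 ⊢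
  rw [← Matrix.mul_assoc, hSd, sub_eq_iff_eq_add, ← Matrix.one_mul V]
  conv_lhs => rw [← h1]
  simp only [Matrix.add_mul, Matrix.one_mul, Matrix.mul_assoc]
  exact add_comm _ _

/-- The disturbance along the optimal trajectory equals the costate. -/
theorem riccati_succ_sub (k : ℕ) :
    riccati Y X (k + 1) - X (k + 1) * (riccati Y X k *
      (X (k + 1) - riccatiGain Y X k * Y (k + 1))ᵀ) = 1 := by
  have h := output_riccati Y X k
  rw [riccati_succ, Matrix.mul_one, ← h]
  simp only [Matrix.sub_mul, Matrix.mul_assoc]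
  abel

/-- Every `Π η`, with `Π` the Riccati matrix at index `K`, is reached by a trajectory whose initial
state, disturbances and outputs have squared norm at most `ηᵀ Π η`. -/
theorem exists_trajectory_riccati (K : ℕ) (η : Fin p → ℝ) :
    ∃ x : ℕ → Fin p → ℝ, x K = riccati Y X K *ᵥ η ∧
      ‖WithLp.toLp 2 (x 0)‖ ^ 2 ≤ quad (riccati Y X K) η ∧
      (∀ k < K, ‖WithLp.toLp 2 (x (k + 1) - X (k + 1) *ᵥ x k)‖ ^ 2 ≤ quad (riccati Y X K) η) ∧
      (∀ k < K, ‖WithLp.toLp 2 (Y (k + 1) *ᵥ x k)‖ ^ 2 ≤ quad (riccati Y X K) η) := by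
  induction K generalizing η with
  | zero => exact ⟨fun _ => η, by simp [riccati], by simp [riccati, quad_one], by simp, by simp⟩
  | succ K ih =>
    obtain ⟨x, hxK, hx0, hw, hy⟩ := ih ((X (K + 1) - riccatiGain Y X K * Y (K + 1))ᵀ *ᵥ η)
    have hq := quad_riccati_succ Y X K η
    have hη : ‖WithLp.toLp 2 η‖ ^ 2 ≤ quad (riccati Y X (K + 1)) η := by
      have := quad_nonneg (posSemidef_riccati Y X K)
        ((X (K + 1) - riccatiGain Y X K * Y (K + 1))ᵀ *ᵥ η)
      rw [hq]
      linarith [sq_nonneg ‖WithLp.toLp 2 ((riccatiGain Y X K)ᵀ *ᵥ η)‖]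
    have hL : ‖WithLp.toLp 2 ((riccatiGain Y X K)ᵀ *ᵥ η)‖ ^ 2 ≤
        quad (riccati Y X (K + 1)) η := by
      have := quad_nonneg (posSemidef_riccati Y X K)
        ((X (K + 1) - riccatiGain Y X K * Y (K + 1))ᵀ *ᵥ η)
      rw [hq]
      linarith [sq_nonneg ‖WithLp.toLp 2 η‖]
    have hle : quad (riccati Y X K) ((X (K + 1) - riccatiGain Y X K * Y (K + 1))ᵀ *ᵥ η) ≤
        quad (riccati Y X (K + 1)) η := by
      rw [hq]
      linarith [sq_nonneg ‖WithLp.toLp 2 η‖,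
        sq_nonneg ‖WithLp.toLp 2 ((riccatiGain Y X K)ᵀ *ᵥ η)‖]
    refine ⟨fun k => if k ≤ K then x k else riccati Y X (K + 1) *ᵥ η, by simp, ?_, ?_, ?_⟩
    · simpa using hx0.trans hle
    · intro k hk
      dsimp only
      rcases Nat.lt_succ_iff_lt_or_eq.1 hk with hk | rfl
      · rw [if_pos (by omega), if_pos (by omega)]
        exact (hw k hk).trans hle
      · rw [if_neg (by omega), if_pos le_rfl, hxK, mulVec_mulVec, mulVec_mulVec, ← sub_mulVec,
          Matrix.mul_assoc, riccati_succ_sub, one_mulVec]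
        exact hη
    · intro k hk
      dsimp only
      rw [if_pos (by omega)]
      rcases Nat.lt_succ_iff_lt_or_eq.1 hk with hk | rfl
      · exact (hy k hk).trans hle
      · rw [hxK, mulVec_mulVec, mulVec_mulVec, output_riccati]
        exact hL

variable {Y X}

theorem UniformlyDetectable.exists_riccati_bound (h : UniformlyDetectable Y X) {b β : ℝ}
    (hX : ∀ k, ‖X (k + 1)‖ ≤ b) (hY : ∀ k, ‖Y (k + 1)‖ ≤ β) :
    ∃ c : ℝ, 0 ≤ c ∧ ∀ k η, quad (riccati Y X k) η ≤ c * ‖WithLp.toLp 2 η‖ ^ 2 := by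
  obtain ⟨c, hc, hbound⟩ := h.exists_state_bound hX hY
  refine ⟨c ^ 2, sq_nonneg c, fun k η => ?_⟩
  obtain ⟨x, hxk, hx0, hw, hy⟩ := exists_trajectory_riccati Y X k η
  have hq := quad_nonneg (posSemidef_riccati Y X k) η
  have hmain := hbound k (Real.sqrt (quad (riccati Y X k) η)) x (Real.sqrt_nonneg _)
    (Real.le_sqrt_of_sq_le hx0) (fun j hj => Real.le_sqrt_of_sq_le (hw j hj))
    (fun j hj => Real.le_sqrt_of_sq_le (hy j hj))
  rw [hxk] at hmain
  -- `r² = ηᵀ Π η ≤ ‖η‖ ‖Π η‖ ≤ ‖η‖ c r`, hence `r ≤ c ‖η‖`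
  have hcs := dotProduct_le_norm_mul_norm η (riccati Y X k *ᵥ η)
  change quad (riccati Y X k) η ≤ _ at hcs
  rw [← mul_pow]
  set r := Real.sqrt (quad (riccati Y X k) η) with hr
  have hr0 : 0 ≤ r := Real.sqrt_nonneg _
  have hr2 : quad (riccati Y X k) η = r ^ 2 := (Real.sq_sqrt hq).symm
  rw [hr2] at hcs ⊢
  refine pow_le_pow_left₀ hr0 ?_ 2
  have hN := norm_nonneg (WithLp.toLp 2 η)
  rcases hr0.eq_or_lt with h0 | hpos
  · rw [← h0]; positivity
  · refine le_of_mul_le_mul_right ?_ hpos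
    calc r * r = r ^ 2 := by ring
      _ ≤ ‖WithLp.toLp 2 η‖ * (c * r) := hcs.trans (by gcongr)
      _ = _ := by ring

end Riccati

/-! ### The coupled prediction step -/

section Coupling

variable {s : ℕ} {n : Fin s → ℕ} {A : ∀ i j : Fin s, Matrix (Fin (n i)) (Fin (n j)) ℝ}
  {θ : Fin s → ℝ} {Q P : ∀ i : Fin s, Matrix (Fin (n i)) (Fin (n i)) ℝ}

theorem exists_nonneg_upper_bound (f : Fin s → ℝ) : ∃ c, 0 ≤ c ∧ ∀ i, f i ≤ c :=
  ⟨∑ i, |f i|, Finset.sum_nonneg fun _ _ => abs_nonneg _, fun i => (le_abs_self _).trans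
    (Finset.single_le_sum (f := fun i => |f i|) (fun _ _ => abs_nonneg _) (Finset.mem_univ i))⟩

theorem quad_predict (i : Fin s) (x : Fin (n i) → ℝ) :
    quad (predict A θ Q P i) x = θ i ^ 2 * (quad (P i) ((A i i)ᵀ *ᵥ x) +
      ∑ j ∈ inNeighbours A i, quad (P j) ((A i j)ᵀ *ᵥ x)) + quad (Q i) x := by
  have hi : i ∉ inNeighbours A i := by simp [inNeighbours]
  rw [predict, quad_add, quad_smul, quad_sum, Finset.sum_insert hi]
  simp only [quad_conj]

theorem posSemidef_predict (hQ : ∀ i, (Q i).PosSemidef) (hP : ∀ i, (P i).PosSemidef) (i : Fin s) :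
    (predict A θ Q P i).PosSemidef :=
  ((posSemidef_sum _ fun j _ => posSemidef_conj (hP j) (A i j)).smul (sq_nonneg (θ i))).add (hQ i)

theorem sum_inNeighbours_le {a c : ℝ} (hc : 0 ≤ c) (i : Fin s)
    (hA : ∀ j, i ≠ j → ‖A i j‖ ≤ a) (hP : ∀ j y, quad (P j) y ≤ c * ‖WithLp.toLp 2 y‖ ^ 2)
    (x : Fin (n i) → ℝ) :
    ∑ j ∈ inNeighbours A i, quad (P j) ((A i j)ᵀ *ᵥ x) ≤
      s * (c * (a * ‖WithLp.toLp 2 x‖) ^ 2) := by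
  have h1 : ∀ j ∈ inNeighbours A i, quad (P j) ((A i j)ᵀ *ᵥ x) ≤
      c * (a * ‖WithLp.toLp 2 x‖) ^ 2 := by
    intro j hj
    have hji : i ≠ j := by
      simp only [inNeighbours, Finset.mem_filter] at hj
      exact hj.2.1.symm
    have h := norm_mulVec_le (A i j)ᵀ x
    rw [norm_transpose_eq] at h
    refine (hP j _).trans ?_
    gcongr
    exact h.trans (by gcongr; exact hA j hji)
  have h2 : ((inNeighbours A i).card : ℝ) ≤ s := by
    exact_mod_cast (Finset.card_le_univ _).trans_eq (Fintype.card_fin s)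
  calc _ ≤ (inNeighbours A i).card • (c * (a * ‖WithLp.toLp 2 x‖) ^ 2) :=
        Finset.sum_le_card_nsmul _ _ _ h1
    _ ≤ _ := by rw [nsmul_eq_mul]; gcongr

end Coupling

theorem posDef_of_smul_one_le {ι : Type*} [Fintype ι] [DecidableEq ι] {R : Matrix ι ι ℝ} {r : ℝ}
    (hr : 0 < r) (h : (R - r • (1 : Matrix ι ι ℝ)).PosSemidef) : R.PosDef := by
  have := PosDef.posSemidef_add h (PosDef.one.smul hr)
  rwa [sub_add_cancel] at this

/-- Upper bound of a decoupled prediction `t² B P Bᵀ`, with `P` the updated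
covariance, by the error covariance that an arbitrary gain
`L` produces for the pair with state matrix `√2 t B`. The factor `√2` only helps here: the left-hand
side is half of the prediction with that state matrix. -/
theorem sq_mul_quad_update_le {p q : ℕ} (C : Matrix (Fin q) (Fin p) ℝ)
    {R : Matrix (Fin q) (Fin q) ℝ} {Pbar : Matrix (Fin p) (Fin p) ℝ} (hR : R.PosDef)
    (hP : Pbar.PosSemidef) (t : ℝ) (B : Matrix (Fin p) (Fin p) ℝ) (L : Matrix (Fin p) (Fin q) ℝ)
    (x : Fin p → ℝ) :
    t ^ 2 * quad (update C R Pbar) (Bᵀ *ᵥ x) ≤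
      quad Pbar (((Real.sqrt 2 * t) • B - L * C)ᵀ *ᵥ x) + quad R (Lᵀ *ᵥ x) := by
  have h1 := quad_update_le C hR hP ((Real.sqrt 2 * t) • B) L x
  have h2 : quad (update C R Pbar) (((Real.sqrt 2 * t) • B)ᵀ *ᵥ x) =
      2 * t ^ 2 * quad (update C R Pbar) (Bᵀ *ᵥ x) := by
    rw [transpose_smul, smul_mulVec, quad, mulVec_smul, dotProduct_smul, smul_dotProduct, quad,
      smul_eq_mul, smul_eq_mul, ← mul_assoc, ← pow_two, mul_pow, Real.sq_sqrt (by norm_num)]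
  have h3 := quad_nonneg (posSemidef_update C hR hP) (Bᵀ *ᵥ x)
  nlinarith [sq_nonneg t, mul_nonneg (sq_nonneg t) h3]

end InterconnectedSystem

open InterconnectedSystem Matrix in
theorem theorem3 {s : ℕ} (n m : Fin s → ℕ)
    (Adiag : ℕ → ∀ i : Fin s, Matrix (Fin (n i)) (Fin (n i)) ℝ)
    (C : ℕ → ∀ i : Fin s, Matrix (Fin (m i)) (Fin (n i)) ℝ)
    (θ : ℕ → Fin s → ℝ)
    (Q : ℕ → ∀ i : Fin s, Matrix (Fin (n i)) (Fin (n i)) ℝ)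
    (R : ℕ → ∀ i : Fin s, Matrix (Fin (m i)) (Fin (m i)) ℝ)
    (hA : ∃ b : ℝ, ∀ k i, ‖Adiag k i‖ ≤ b)
    (hC : ∃ b : ℝ, ∀ k i, ‖C (k + 1) i‖ ≤ b)
    (hQ : ∀ i, ∃ qu : ℝ, 0 ≤ qu ∧ ∀ k,
      (Q k i).PosSemidef ∧ (qu • (1 : Matrix (Fin (n i)) (Fin (n i)) ℝ) - Q k i).PosSemidef)
    (hR : ∀ i, ∃ rl ru : ℝ, 0 < rl ∧ rl ≤ ru ∧ ∀ k,
      (R (k + 1) i - rl • (1 : Matrix (Fin (m i)) (Fin (m i)) ℝ)).PosSemidef ∧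
      (ru • (1 : Matrix (Fin (m i)) (Fin (m i)) ℝ) - R (k + 1) i).PosSemidef)
    (hθ : ∀ i, ∃ θl θu : ℝ, 0 < θl ∧ 0 < θu ∧ ∀ k, θl ≤ |θ k i| ∧ |θ k i| ≤ θu) :
    ∃ a : ℝ, 0 < a ∧
      ∀ A : ℕ → ∀ i j : Fin s, Matrix (Fin (n i)) (Fin (n j)) ℝ,
        (∀ k i, A k i i = Adiag k i) →
        (∀ k i j, i ≠ j → ‖A k i j‖ ≤ a) →
        (∀ i, InterconnectedSystem.UniformlyDetectable (fun k => C k i)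
          (fun k => (Real.sqrt 2 * θ k i) • A k i i)) →
        ∀ P0 : ∀ i : Fin s, Matrix (Fin (n i)) (Fin (n i)) ℝ, (∀ i, (P0 i).PosSemidef) →
          ∃ p : ℝ, 0 ≤ p ∧ ∀ k : ℕ,
            (p • (1 : Matrix ((i : Fin s) × Fin (n i)) ((i : Fin s) × Fin (n i)) ℝ) -
              Matrix.blockDiagonal'
                (InterconnectedSystem.dmre A C θ Q R P0 k)).PosSemidef := by
  by_cases hdet : ∀ i, UniformlyDetectable (fun k => C k i)
      (fun k => (Real.sqrt 2 * θ k i) • Adiag k i)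
  swap
  · -- detectability involves the local data only, so it fails for every coupling
    exact ⟨1, one_pos, fun A hAd _ hd => absurd (fun i => by simpa only [hAd] using hd i) hdet⟩
  obtain ⟨b, hb⟩ := hA
  obtain ⟨β, hβ⟩ := hC
  choose qu _ hqu using hQ
  choose rl ru hrl _ hR using hR
  choose θl θu _ _ hθu using hθ
  obtain ⟨q, hq0, hq⟩ := exists_nonneg_upper_bound qu
  obtain ⟨r, hr0, hr⟩ := exists_nonneg_upper_bound ru
  obtain ⟨Θ, hΘ0, hΘ⟩ := exists_nonneg_upper_bound θu
  have hQpsd : ∀ k i, (Q k i).PosSemidef := fun k i => (hqu i k).1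
  have hRpd : ∀ k i, (R (k + 1) i).PosDef := fun k i => posDef_of_smul_one_le (hrl i) (hR i k).1
  have hQle : ∀ k i x, quad (Q k i) x ≤ q * ‖WithLp.toLp 2 x‖ ^ 2 := fun k i x => by
    have h := quad_nonneg (hqu i k).2 x
    rw [quad_sub, quad_smul_one, sub_nonneg] at h
    exact h.trans (by gcongr; exact hq i)
  have hRle : ∀ k i x, quad (R (k + 1) i) x ≤ r * ‖WithLp.toLp 2 x‖ ^ 2 := fun k i x => by
    have h := quad_nonneg (hR i k).2 x
    rw [quad_sub, quad_smul_one, sub_nonneg] at h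
    exact h.trans (by gcongr; exact hr i)
  have hθsq : ∀ k i, θ k i ^ 2 ≤ Θ ^ 2 := fun k i => by
    rw [← sq_abs]
    exact pow_le_pow_left₀ (abs_nonneg _) ((hθu i k).2.trans (hΘ i)) 2
  have hXnorm : ∀ k i, ‖(Real.sqrt 2 * θ k i) • Adiag k i‖ ≤ Real.sqrt 2 * Θ * b := fun k i => by
    rw [norm_smul, norm_mul, Real.norm_eq_abs, Real.norm_eq_abs,
      abs_of_nonneg (Real.sqrt_nonneg 2)]
    gcongr
    · exact (hθu i k).2.trans (hΘ i)
    · exact hb k i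
  have hV := fun i => (hdet i).exists_riccati_bound (fun k => hXnorm (k + 1) i) (fun k => hβ k i)
  choose c' _ hc' using hV
  obtain ⟨π, hπ0, hπ⟩ := exists_nonneg_upper_bound c'
  set V := fun i => riccati (fun k => C k i) (fun k => (Real.sqrt 2 * θ k i) • Adiag k i)
  have hVle : ∀ k i x, quad (V i k) x ≤ π * ‖WithLp.toLp 2 x‖ ^ 2 := fun k i x =>
    (hc' i k x).trans (by gcongr; exact hπ i)
  -- small enough that the coupling costs at most half of the unit process noise in `V`
  set B : ℝ := Θ ^ 2 * s * π with hB
  have hB0 : 0 ≤ B := by positivity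
  have haB : B * (1 / (2 * (B + 1))) ^ 2 ≤ 1 / 2 := by
    rw [div_pow, one_pow, mul_one_div, div_le_div_iff₀ (by positivity) (by norm_num)]
    nlinarith
  refine ⟨1 / (2 * (B + 1)), by positivity, fun A hAd hAa _ P0 hP0 => ?_⟩
  generalize 1 / (2 * (B + 1)) = a at haB hAa
  set P := dmre A C θ Q R P0
  -- as for `V`, index `k` of `Pbar` belongs to time `k + 1`
  set Pbar := fun k i => predict (A k) (θ k) (Q k) (P k) i
  have hPsucc : ∀ k i, P (k + 1) i = update (C (k + 1) i) (R (k + 1) i) (Pbar k i) :=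
    fun _ _ => rfl
  have hPpsd : ∀ k i, (P k i).PosSemidef := by
    intro k
    induction k with
    | zero => exact hP0
    | succ k ih =>
      exact fun i => posSemidef_update _ (hRpd k i) (posSemidef_predict (hQpsd k) ih i)
  have hPbarpsd : ∀ k i, (Pbar k i).PosSemidef := fun k i =>
    posSemidef_predict (hQpsd k) (hPpsd k) i
  obtain ⟨p1, hp1, hp1le⟩ := exists_nonneg_upper_bound fun i => ‖Pbar 0 i‖
  obtain ⟨p0, hp0, hp0le⟩ := exists_nonneg_upper_bound fun i => ‖P 0 i‖
  set c : ℝ := p1 + r + 2 * q with hc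
  have hc0 : 0 ≤ c := by positivity
  have hcr : r ≤ c := by linarith
  have hcq : q ≤ c / 2 := by linarith
  have hcp : p1 ≤ c := by linarith
  have key : ∀ k i x, quad (Pbar k i) x ≤ c * quad (V i k) x := by
    intro k
    induction k with
    | zero =>
      intro i x
      calc _ ≤ ‖Pbar 0 i‖ * ‖WithLp.toLp 2 x‖ ^ 2 := quad_le_norm_mul _ _
        _ ≤ c * ‖WithLp.toLp 2 x‖ ^ 2 := by gcongr; exact (hp1le i).trans hcp
        _ = _ := by rw [← quad_one]; rfl
    | succ k ih =>
      intro i x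
      have hPle : ∀ j y, quad (P (k + 1) j) y ≤ c * π * ‖WithLp.toLp 2 y‖ ^ 2 := fun j y => by
        rw [hPsucc, mul_assoc]
        refine (quad_update_le_self _ (hRpd k j) (hPbarpsd k j) y).trans ((ih j y).trans ?_)
        gcongr
        exact hVle k j y
      have hcoup := sum_inNeighbours_le (A := A (k + 1)) (P := P (k + 1)) (mul_nonneg hc0 hπ0) i
        (hAa (k + 1) i) hPle x
      set L := riccatiGain (fun k => C k i) (fun k => (Real.sqrt 2 * θ k i) • Adiag k i) k with hL
      have hloc := sq_mul_quad_update_le (C (k + 1) i) (hRpd k i) (hPbarpsd k i) (θ (k + 1) i)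
        (Adiag (k + 1) i) L x
      rw [← hPsucc] at hloc
      have hric : quad (V i (k + 1)) x = _ := quad_riccati_succ (fun k => C k i)
        (fun k => (Real.sqrt 2 * θ k i) • Adiag k i) k x
      rw [← hL] at hric
      have hN : 0 ≤ ‖WithLp.toLp 2 x‖ ^ 2 := sq_nonneg _
      have hcoup' : θ (k + 1) i ^ 2 *
          ∑ j ∈ inNeighbours (A (k + 1)) i, quad (P (k + 1) j) ((A (k + 1) i j)ᵀ *ᵥ x) ≤
            c / 2 * ‖WithLp.toLp 2 x‖ ^ 2 :=
        calc _ ≤ Θ ^ 2 * (s * (c * π * (a * ‖WithLp.toLp 2 x‖) ^ 2)) :=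
              mul_le_mul (hθsq _ _) hcoup
                (Finset.sum_nonneg fun j _ => quad_nonneg (hPpsd _ j) _) (sq_nonneg _)
          _ = c * (B * a ^ 2) * ‖WithLp.toLp 2 x‖ ^ 2 := by rw [hB]; ring
          _ ≤ c * (1 / 2) * ‖WithLp.toLp 2 x‖ ^ 2 := by gcongr
          _ = _ := by ring
      have h1 := ih i (((Real.sqrt 2 * θ (k + 1) i) • Adiag (k + 1) i - L * C (k + 1) i)ᵀ *ᵥ x)
      have h2 := (hRle k i (Lᵀ *ᵥ x)).trans
        (mul_le_mul_of_nonneg_right hcr (sq_nonneg ‖WithLp.toLp 2 (Lᵀ *ᵥ x)‖))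
      have h3 := (hQle (k + 1) i x).trans (mul_le_mul_of_nonneg_right hcq hN)
      have h4 : quad (Pbar (k + 1) i) x = _ := quad_predict i x
      rw [h4, hric, hAd, mul_add]
      linarith
  refine ⟨p0 + c * π, by positivity, fun k => ?_⟩
  refine posSemidef_smul_one_sub (posSemidef_blockDiagonal' (hPpsd k))
    (quad_blockDiagonal'_le _ fun i x => ?_)
  rw [add_mul]
  cases k with
  | zero =>
    calc _ ≤ ‖P 0 i‖ * ‖WithLp.toLp 2 x‖ ^ 2 := quad_le_norm_mul _ _
      _ ≤ p0 * ‖WithLp.toLp 2 x‖ ^ 2 := by gcongr; exact hp0le i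
      _ ≤ _ := le_add_of_nonneg_right (by positivity)
  | succ k =>
    calc _ ≤ quad (Pbar k i) x := quad_update_le_self _ (hRpd k i) (hPbarpsd k i) x
      _ ≤ c * (π * ‖WithLp.toLp 2 x‖ ^ 2) := (key k i x).trans (by gcongr; exact hVle k i x)
      _ ≤ _ := by rw [mul_assoc]; exact le_add_of_nonneg_left (by positivity)
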